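/- **The locker game.** For $n\ge 2$ let $\sigma$ be a uniformly random permutation of $\{1,\dots,n\}$; the number $i$ is placed in locker $\sigma(i)$. Player $i$ ($1\le i\le n$) must output $\sigma(i)$, and has access to $\sigma$ only through quantum queries $|x,b,z\rangle\mapsto|x,b\oplus f_i(x),z\rangle$ to the weak oracle $f_i(x)=1$ if $\sigma(i)=x$ and $f_i(x)=0$ otherwise. The team wins if all the players are correct; the winning probability is taken over $\sigma$ and over the final measurements. Each player's algorithm consists of arbitrary unitaries on a finite-dimensional register, interleaved with a number of queries. *The original game.* The players cannot communicate: each has a register of his own and a number $t_i$ of queries fixed in advance (the joint initial state of the registers is independent of $\sigma$, and may be entangled). *The sequential game.* The players act in the order $1,\dots,n$. Player $i$ is told $\sigma(1),\dots,\sigma(i-1)$ and receives the whole quantum memory that the earlier players leave behind; he queries only $f_i$, and announces his guess before the next player starts. His algorithm and the number of his queries $t_i(\sigma)=t_i(\sigma(1),\dots,\sigma(i-1))$ may depend on what he is told. **Theorem 2.** There is an absolute constant $c>0$ such that for all $n\ge2$: 1. In the original game, every strategy that wins with probability one makes a total of $\sum_i t_i\ge c\,n\sqrt n$ queries. 2.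 In the sequential game, for every strategy that wins with probability one and for every permutation $\sigma$, player $i$ makes $t_i(\sigma)\ge c\sqrt{n-i}$ queries, for each $1\le i\le n$, and the total number of queries is $\sum_i t_i(\sigma)\ge c\,n\sqrt n$. That is, the total number of queries required for success probability one is in $\Omega(n\sqrt n)$. -/

import Mathlib

/-! The locker game: the number `i` sits in locker `σ i`, where `σ` is a uniformly random
permutation of `Fin n`, and player `i` has to guess the locker `σ i`, using quantum queries to the
indicator function of that locker. -/

namespace LockerGame

noncomputable section

/-- The oracle of player `i`: it tells whether locker `x` contains the number `i`. -/
def weakOracle {n : ℕ} (σ : Equiv.Perm (Fin n)) (i x : Fin n) : Bool := decide (σ i = x)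

/-- Computational basis of a quantum register: a locker number (the query), an answer bit, and
`w` basis states of additional workspace. -/
abbrev QBasis (n w : ℕ) : Type := Fin n × Bool × Fin w

/-- One quantum query to `f`, that is `|x, b, z⟩ ↦ |x, b ⊕ f x, z⟩`, as a matrix. -/
def queryMatrix {n : ℕ} (f : Fin n → Bool) (w : ℕ) :
    Matrix (QBasis n w) (QBasis n w) ℂ :=
  Matrix.of fun a b => if a = (b.1, xor b.2.1 (f b.1), b.2.2) then 1 else 0

/-- The `t`-query quantum algorithm `U t * O_f * U (t-1) * O_f * ⋯ * O_f * U 0` with arbitrary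
unitaries `U 0, …, U t` that do not depend on the oracle. -/
def runMatrix {n w : ℕ} (f : Fin n → Bool) (U : ℕ → Matrix.unitaryGroup (QBasis n w) ℂ) :
    ℕ → Matrix (QBasis n w) (QBasis n w) ℂ
  | 0 => (U 0 : Matrix (QBasis n w) (QBasis n w) ℂ)
  | t + 1 => (U (t + 1) : Matrix (QBasis n w) (QBasis n w) ℂ) * (queryMatrix f w * runMatrix f U t)

/-- A strategy for `n` quantum players who cannot communicate. Each player has a register of his
own; the joint initial state of all the registers may be entangled (it is fixed before `σ` is
chosen). Product states are the case of no entanglement, and shared randomness is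
the case of an initial state whose shared part is only read. -/
structure Strategy (n : ℕ) where
  /-- workspace size of each player -/
  w : Fin n → ℕ
  /-- number of queries of each player -/
  queries : Fin n → ℕ
  /-- the unitaries that each player applies between his queries -/
  U : (i : Fin n) → ℕ → Matrix.unitaryGroup (QBasis n (w i)) ℂ
  /-- amplitudes of the joint initial state -/
  init : ((i : Fin n) → QBasis n (w i)) → ℂ
  init_norm : ∑ a, ‖init a‖ ^ 2 = 1
  /-- the guess each player makes from the measurement of his final register -/
  guess : (i : Fin n) → QBasis n (w i) → Fin n

namespace Strategy

variable {n : ℕ} (S : Strategy n)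

/-- The joint final state: the tensor product of the players' algorithms, player `i` querying
`weakOracle σ i`, applied to the joint initial state. -/
def finalState (σ : Equiv.Perm (Fin n)) (a : (i : Fin n) → QBasis n (S.w i)) : ℂ :=
  ∑ b : (i : Fin n) → QBasis n (S.w i),
    (∏ i, runMatrix (weakOracle σ i) (S.U i) (S.queries i) (a i) (b i)) * S.init b

/-- Probability that all the players guess correctly, for a given permutation `σ`. -/
def winProbAt (σ : Equiv.Perm (Fin n)) : ℝ :=
  ∑ a : (i : Fin n) → QBasis n (S.w i) with (∀ i, S.guess i (a i) = σ i), ‖S.finalState σ a‖ ^ 2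

/-- Probability that the team wins, for a uniformly random permutation. -/
def winProb : ℝ := (∑ σ : Equiv.Perm (Fin n), S.winProbAt σ) / (n.factorial : ℝ)

/-- Total number of queries of the team. -/
def totalQueries : ℕ := ∑ i, S.queries i

end Strategy

/-- What player `i` of the sequential game is told: the lockers of the numbers `j < i`. -/
def history {n : ℕ} (σ : Equiv.Perm (Fin n)) (i : Fin n) : Fin (i : ℕ) → Fin n :=
  fun j => σ (Fin.castLE i.isLt.le j)

/-- A strategy for the sequential game. The players act in the order `0, 1, …, n - 1`. Player `i`
receives the whole quantum memory that his predecessors leave behind and is told the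
lockers of the numbers `j < i`; his algorithm and the number of his queries may depend on these.
He queries his own oracle only, and announces his guess before the next player starts. -/
structure SeqStrategy (n : ℕ) where
  /-- workspace size -/
  w : ℕ
  /-- amplitudes of the initial state -/
  init : QBasis n w → ℂ
  init_norm : ∑ a, ‖init a‖ ^ 2 = 1
  /-- number of queries of player `i`, given what he was told -/
  queries : (i : Fin n) → (Fin (i : ℕ) → Fin n) → ℕ
  /-- unitaries of player `i`, given what he was told -/
  U : (i : Fin n) → (Fin (i : ℕ) → Fin n) → ℕ → Matrix.unitaryGroup (QBasis n w) ℂ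
  /-- the guess of player `i` is the outcome of the measurement of this observable -/
  guess : (i : Fin n) → (Fin (i : ℕ) → Fin n) → QBasis n w → Fin n

namespace SeqStrategy

variable {n : ℕ} (S : SeqStrategy n)

/-- The turn of player `i`: he runs his algorithm with oracle `weakOracle σ i` and measures his
guess. The result is the unnormalized state after the outcome `σ i`; its squared norm is multiplied
by the probability that the guess is correct. -/
def turn (σ : Equiv.Perm (Fin n)) (i : Fin n) (ψ : QBasis n S.w → ℂ) : QBasis n S.w → ℂ :=
  fun a =>
    if S.guess i (history σ i) a = σ i then
      (runMatrix (weakOracle σ i) (S.U i (history σ i)) (S.queries i (history σ i))).mulVec ψ a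
    else 0

/-- Unnormalized state after the first `k` players have acted and guessed correctly. -/
def stateAfter (σ : Equiv.Perm (Fin n)) : ℕ → QBasis n S.w → ℂ
  | 0 => S.init
  | k + 1 => if h : k < n then S.turn σ ⟨k, h⟩ (stateAfter σ k) else stateAfter σ k

/-- Probability that all the players guess correctly, for a given permutation `σ`. -/
def winProbAt (σ : Equiv.Perm (Fin n)) : ℝ := ∑ a, ‖S.stateAfter σ n a‖ ^ 2

/-- Probability that the team wins, for a uniformly random permutation. -/
def winProb : ℝ := (∑ σ : Equiv.Perm (Fin n), S.winProbAt σ) / (n.factorial : ℝ)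

/-- Number of queries that player `i` makes when the permutation is `σ` (and his predecessors
have guessed correctly). -/
def queriesAt (σ : Equiv.Perm (Fin n)) (i : Fin n) : ℕ := S.queries i (history σ i)

end SeqStrategy

end

end LockerGame

/-! Winning with certainty makes each player an exact search algorithm, so the hybrid argument
applies. `card_le_of_exact_search` carries it: run one algorithm on one start vector with each
target in `X`. The final states are pairwise orthogonal, so all but one are far from the run with
the empty oracle, while `t` queries carry total weight `t` to spread over the targets; hence `#X - 1
≤ 8 t²`.

It remains to find many targets for the same start vector. In the sequential game, swapping `σ i`
with a later value changes neither what player `i` is told nor the state he receives, leaving `n -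
i` targets (`i` counted from zero). In the original game, entanglement is removed by undoing the
other players' unitaries: player `i` must be exact on each slice of the initial state along his
register, and every locker is a possible target. Summing the square roots gives order `n√n`. -/

namespace LockerGame

open Matrix Finset

/-- The `ℓ²` norm of a vector of amplitudes. -/
noncomputable def l2norm {ι : Type*} [Fintype ι] (v : ι → ℂ) : ℝ := ‖WithLp.toLp 2 v‖

/-! ### Norms of amplitude vectors -/

section L2

variable {ι : Type*} [Fintype ι]

theorem l2norm_nonneg (v : ι → ℂ) : 0 ≤ l2norm v := norm_nonneg _

theorem l2norm_sq (v : ι → ℂ) : l2norm v ^ 2 = ∑ a, ‖v a‖ ^ 2 := by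
  simp [l2norm, EuclideanSpace.norm_sq_eq]

theorem l2norm_add_le (v u : ι → ℂ) : l2norm (v + u) ≤ l2norm v + l2norm u := by
  simpa [l2norm] using norm_add_le (WithLp.toLp 2 v) (WithLp.toLp 2 u)

theorem l2norm_sub_le (v u : ι → ℂ) : l2norm (v - u) ≤ l2norm v + l2norm u := by
  simpa [l2norm] using norm_sub_le (WithLp.toLp 2 v) (WithLp.toLp 2 u)

theorem l2norm_pos {v : ι → ℂ} (hv : v ≠ 0) : 0 < l2norm v := by
  rw [l2norm, norm_pos_iff]
  simpa using hv

theorem l2norm_mulVec [DecidableEq ι] {M : Matrix ι ι ℂ} (hM : M ∈ unitaryGroup ι ℂ)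
    (v : ι → ℂ) : l2norm (M *ᵥ v) = l2norm v := by
  have key : ∀ u : ι → ℂ, ((l2norm u ^ 2 : ℝ) : ℂ) = star u ⬝ᵥ u := by
    intro u
    rw [l2norm_sq]
    push_cast
    refine Finset.sum_congr rfl fun a _ => ?_
    rw [← Complex.conj_mul']
    rfl
  have h : ((l2norm (M *ᵥ v) ^ 2 : ℝ) : ℂ) = ((l2norm v ^ 2 : ℝ) : ℂ) := by
    rw [key, key, star_mulVec, dotProduct_mulVec, vecMul_vecMul]
    have := (mem_unitaryGroup_iff').1 hM
    rw [star_eq_conjTranspose] at this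
    rw [this, vecMul_one]
  have h' : l2norm (M *ᵥ v) ^ 2 = l2norm v ^ 2 := by exact_mod_cast h
  exact (pow_left_inj₀ (l2norm_nonneg _) (l2norm_nonneg _) two_ne_zero).1 h'

/-- Vectors with disjoint supports satisfy the Pythagorean identity. -/
theorem l2norm_sub_sq_of_disjoint {v u : ι → ℂ} (h : ∀ a, v a = 0 ∨ u a = 0) :
    l2norm (v - u) ^ 2 = l2norm v ^ 2 + l2norm u ^ 2 := by
  simp only [l2norm_sq, ← Finset.sum_add_distrib]
  refine Finset.sum_congr rfl fun a _ => ?_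
  rcases h a with h | h <;> simp [h]

/-- If restricting a vector to a set does not decrease its norm, then it vanishes off the set. -/
theorem eq_zero_of_l2norm_le_restrict {v : ι → ℂ} {p : ι → Prop} [DecidablePred p]
    (h : l2norm v ≤ l2norm fun a => if p a then v a else 0) {a : ι} (ha : ¬ p a) : v a = 0 := by
  have h2 := pow_le_pow_left₀ (l2norm_nonneg _) h 2
  rw [l2norm_sq, l2norm_sq] at h2
  have hle : ∀ b ∈ univ, ‖(if p b then v b else 0)‖ ^ 2 ≤ ‖v b‖ ^ 2 := by
    intro b _
    split_ifs <;> simp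
  have := (Finset.sum_eq_sum_iff_of_le hle).1 (le_antisymm (Finset.sum_le_sum hle) h2) a
    (mem_univ a)
  simpa [ha] using this.symm

theorem l2norm_restrict_le (v : ι → ℂ) (p : ι → Prop) [DecidablePred p] :
    (l2norm fun a => if p a then v a else 0) ≤ l2norm v := by
  refine (sq_le_sq₀ (l2norm_nonneg _) (l2norm_nonneg _)).1 ?_
  rw [l2norm_sq, l2norm_sq]
  refine Finset.sum_le_sum fun b _ => ?_
  split_ifs <;> simp

end L2

/-! ### The hybrid argument for exact search -/

section Query

variable {n w : ℕ}

theorem queryMatrix_mulVec (f : Fin n → Bool) (v : QBasis n w → ℂ) (a : QBasis n w) :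
    (queryMatrix f w *ᵥ v) a = v (a.1, xor a.2.1 (f a.1), a.2.2) := by
  have : ∀ b : QBasis n w, queryMatrix f w a b =
      if b = (a.1, xor a.2.1 (f a.1), a.2.2) then 1 else 0 := by
    intro b
    rw [queryMatrix, of_apply]
    congr 1
    apply propext
    constructor
    · rintro rfl
      simp
    · rintro rfl
      simp
  simp [mulVec, dotProduct, this]

theorem queryMatrix_mem_unitaryGroup (f : Fin n → Bool) :
    queryMatrix f w ∈ unitaryGroup (QBasis n w) ℂ := by
  have hstar : star (queryMatrix f w) = queryMatrix f w := by
    ext a b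
    rw [star_apply, queryMatrix, of_apply, of_apply]
    have : (b = (a.1, xor a.2.1 (f a.1), a.2.2)) ↔ (a = (b.1, xor b.2.1 (f b.1), b.2.2)) := by
      constructor <;> · rintro rfl; simp
    simp only [this]
    split_ifs <;> simp
  rw [mem_unitaryGroup_iff, hstar]
  refine Matrix.ext_of_mulVec_single fun b => ?_
  rw [← mulVec_mulVec, one_mulVec]
  ext a
  rw [queryMatrix_mulVec, queryMatrix_mulVec]
  simp

theorem runMatrix_mem_unitaryGroup (f : Fin n → Bool)
    (U : ℕ → unitaryGroup (QBasis n w) ℂ) (t : ℕ) :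
    runMatrix f U t ∈ unitaryGroup (QBasis n w) ℂ := by
  induction t with
  | zero => exact (U 0).2
  | succ t ih => exact mul_mem (U (t + 1)).2 (mul_mem (queryMatrix_mem_unitaryGroup f) ih)

/-- The part of a state in which locker `x` is queried. -/
def queryPart (x : Fin n) (v : QBasis n w → ℂ) : QBasis n w → ℂ :=
  fun a => if a.1 = x then v a else 0

theorem sum_l2norm_queryPart_sq (v : QBasis n w → ℂ) :
    ∑ x, l2norm (queryPart x v) ^ 2 = l2norm v ^ 2 := by
  simp only [l2norm_sq]
  rw [Finset.sum_comm]
  refine Finset.sum_congr rfl fun a _ => ?_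
  rw [Finset.sum_eq_single a.1]
  · simp [queryPart]
  · intro x _ hx
    simp [queryPart, hx.symm]
  · simp

/-- The query is the identity away from locker `x`, so only that part of the state contributes. -/
theorem l2norm_query_sub_le (x : Fin n) (v : QBasis n w → ℂ) :
    l2norm (queryMatrix (fun y => decide (x = y)) w *ᵥ v - v) ≤ 2 * l2norm (queryPart x v) := by
  have h : queryMatrix (fun y => decide (x = y)) w *ᵥ v - v =
      queryMatrix (fun y => decide (x = y)) w *ᵥ queryPart x v - queryPart x v := by
    ext a
    simp only [Pi.sub_apply, queryMatrix_mulVec, queryPart]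
    by_cases ha : a.1 = x
    · simp [ha]
    · simp [ha, Ne.symm ha]
  rw [h, two_mul]
  refine (l2norm_sub_le _ _).trans_eq ?_
  rw [l2norm_mulVec (queryMatrix_mem_unitaryGroup _)]

/-- The hybrid argument: the state of an algorithm that searches for `x` differs from that of the
run with the empty oracle by at most twice the total amplitude of the queries to `x`. -/
theorem l2norm_run_sub_run_le (U : ℕ → unitaryGroup (QBasis n w) ℂ) (ψ : QBasis n w → ℂ)
    (x : Fin n) (t : ℕ) :
    l2norm (runMatrix (fun y => decide (x = y)) U t *ᵥ ψ - runMatrix (fun _ => false) U t *ᵥ ψ) ≤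
      ∑ s ∈ range t, 2 * l2norm (queryPart x (runMatrix (fun _ => false) U s *ᵥ ψ)) := by
  induction t with
  | zero => simp [runMatrix, l2norm]
  | succ t ih =>
    set v := runMatrix (fun y => decide (x = y)) U t *ᵥ ψ
    set u := runMatrix (fun _ => false) U t *ᵥ ψ
    have hu : queryMatrix (fun _ => false) w *ᵥ u = u := by
      ext a
      simp [queryMatrix_mulVec]
    -- The new error is the old one, moved by a unitary, plus the effect of a single query on the
    -- empty-oracle state.
    have h : runMatrix (fun y => decide (x = y)) U (t + 1) *ᵥ ψ -
        runMatrix (fun _ => false) U (t + 1) *ᵥ ψ =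
        (U (t + 1) : Matrix _ _ ℂ) *ᵥ (queryMatrix (fun y => decide (x = y)) w *ᵥ (v - u) +
          (queryMatrix (fun y => decide (x = y)) w *ᵥ u - u)) := by
      simp only [runMatrix, ← mulVec_mulVec]
      rw [hu, ← mulVec_sub, mulVec_sub _ v u, sub_add_sub_cancel]
    rw [h, l2norm_mulVec (U (t + 1)).2, Finset.sum_range_succ]
    refine (l2norm_add_le _ _).trans (add_le_add ?_ (l2norm_query_sub_le x u))
    rwa [l2norm_mulVec (queryMatrix_mem_unitaryGroup _)]

/-- Exact quantum search among the lockers of `X` needs at least `√((#X - 1) / 8)` queries. -/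
theorem card_le_of_exact_search (U : ℕ → unitaryGroup (QBasis n w) ℂ) {ψ : QBasis n w → ℂ}
    (hψ : ψ ≠ 0) (t : ℕ) (g : QBasis n w → Fin n) (X : Finset (Fin n))
    (hX : ∀ x ∈ X, ∀ a, g a ≠ x → (runMatrix (fun y => decide (x = y)) U t *ᵥ ψ) a = 0) :
    (X.card : ℝ) ≤ 8 * (t : ℝ) ^ 2 + 1 := by
  set F : Fin n → QBasis n w → ℂ := fun x => runMatrix (fun y => decide (x = y)) U t *ᵥ ψ with hF
  set φ : ℕ → QBasis n w → ℂ := fun s => runMatrix (fun _ => false) U s *ᵥ ψ with hφ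
  set D : Fin n → ℝ := fun x => l2norm (F x - φ t) with hD
  have hpos := l2norm_pos hψ
  rcases X.eq_empty_or_nonempty with rfl | hne
  · simp; positivity
  obtain ⟨x₀, hx₀, hmin⟩ := X.exists_min_image D hne
  -- Outputs for `x` and `x₀` have disjoint supports, so they are `√2 ‖ψ‖` apart; as `x₀` is the
  -- closest to the empty run, `D x` is at least half of that.
  have hfar : ∀ x ∈ X.erase x₀, l2norm ψ ^ 2 / 2 ≤ D x ^ 2 := by
    intro x hx
    obtain ⟨hne, hxX⟩ := Finset.mem_erase.1 hx
    have h1 : l2norm (F x - F x₀) ^ 2 = l2norm (F x) ^ 2 + l2norm (F x₀) ^ 2 := by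
      refine l2norm_sub_sq_of_disjoint fun a => ?_
      by_cases ha : g a = x
      · exact Or.inr (hX x₀ hx₀ a (ha ▸ hne))
      · exact Or.inl (hX x hxX a ha)
    have h2 : ∀ y, l2norm (F y) = l2norm ψ := fun y =>
      l2norm_mulVec (runMatrix_mem_unitaryGroup _ U t) ψ
    rw [h2, h2] at h1
    have h3 : l2norm (F x - F x₀) ≤ D x + D x₀ := by
      have := l2norm_sub_le (F x - φ t) (F x₀ - φ t)
      rwa [sub_sub_sub_cancel_right] at this
    have h4 : l2norm (F x - F x₀) ≤ 2 * D x := by linarith [hmin x hxX]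
    have h5 := pow_le_pow_left₀ (l2norm_nonneg _) h4 2
    nlinarith
  -- Hybrid bound, then Cauchy–Schwarz over the `t` queries.
  have hnear : ∀ x, D x ^ 2 ≤ 4 * t * ∑ s ∈ range t, l2norm (queryPart x (φ s)) ^ 2 := by
    intro x
    have h1 : D x ≤ ∑ s ∈ range t, 2 * l2norm (queryPart x (φ s)) :=
      l2norm_run_sub_run_le U ψ x t
    rw [← Finset.mul_sum] at h1
    have h2 := pow_le_pow_left₀ (l2norm_nonneg _) h1 2
    have h3 := sq_sum_le_card_mul_sum_sq (s := range t)
      (f := fun s => l2norm (queryPart x (φ s)))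
    rw [card_range] at h3
    nlinarith
  have hsum : ((X.card : ℝ) - 1) * (l2norm ψ ^ 2 / 2) ≤ 4 * (t : ℝ) ^ 2 * l2norm ψ ^ 2 := by
    calc ((X.card : ℝ) - 1) * (l2norm ψ ^ 2 / 2)
        = ∑ x ∈ X.erase x₀, l2norm ψ ^ 2 / 2 := by
          rw [Finset.sum_const, nsmul_eq_mul, Finset.cast_card_erase_of_mem hx₀]
      _ ≤ ∑ x ∈ X.erase x₀, D x ^ 2 := Finset.sum_le_sum hfar
      _ ≤ ∑ x, D x ^ 2 :=
          Finset.sum_le_sum_of_subset_of_nonneg (subset_univ _) fun _ _ _ => sq_nonneg _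
      _ ≤ ∑ x, 4 * t * ∑ s ∈ range t, l2norm (queryPart x (φ s)) ^ 2 :=
          Finset.sum_le_sum fun x _ => hnear x
      _ = 4 * t * ∑ s ∈ range t, l2norm ψ ^ 2 := by
          rw [← Finset.mul_sum, Finset.sum_comm]
          congr 1
          refine Finset.sum_congr rfl fun s _ => ?_
          rw [sum_l2norm_queryPart_sq, hφ, l2norm_mulVec (runMatrix_mem_unitaryGroup _ U s)]
      _ = 4 * (t : ℝ) ^ 2 * l2norm ψ ^ 2 := by
          rw [Finset.sum_const, card_range, nsmul_eq_mul]
          ring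
  have hsq : 0 < l2norm ψ ^ 2 := by positivity
  by_contra! hlt
  nlinarith

end Query

/-- If the average over all permutations of numbers `p σ ≤ 1` is one, then all of them are one. -/
theorem eq_one_of_average_eq_one {n : ℕ} {p : Equiv.Perm (Fin n) → ℝ} (hp : ∀ σ, p σ ≤ 1)
    (h : (∑ σ, p σ) / (n.factorial : ℝ) = 1) (σ : Equiv.Perm (Fin n)) : p σ = 1 := by
  have h1 : ∑ σ, p σ = ∑ _σ : Equiv.Perm (Fin n), (1 : ℝ) := by
    rw [div_eq_one_iff_eq (by positivity)] at h
    rw [h]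
    simp [Fintype.card_perm]
  exact (Finset.sum_eq_sum_iff_of_le fun σ _ => hp σ).1 h1 σ (mem_univ σ)

/-! ### The sequential game -/

namespace SeqStrategy

variable {n : ℕ} (S : SeqStrategy n)

theorem history_congr {σ τ : Equiv.Perm (Fin n)} {i : Fin n} (h : ∀ j < i, σ j = τ j) :
    history σ i = history τ i :=
  funext fun j => h _ (Fin.lt_def.2 j.isLt)

theorem weakOracle_congr {σ τ : Equiv.Perm (Fin n)} {i : Fin n} (h : σ i = τ i) :
    weakOracle σ i = weakOracle τ i := by
  funext x
  simp [weakOracle, h]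

theorem stateAfter_congr {σ τ : Equiv.Perm (Fin n)} (k : ℕ)
    (h : ∀ j : Fin n, (j : ℕ) < k → σ j = τ j) : S.stateAfter σ k = S.stateAfter τ k := by
  induction k with
  | zero => rfl
  | succ k ih =>
    have ih := ih fun j hj => h j (hj.trans k.lt_succ_self)
    by_cases hk : k < n
    · have h1 : history σ ⟨k, hk⟩ = history τ ⟨k, hk⟩ :=
        history_congr fun j hj => h j ((Fin.lt_def.1 hj).trans k.lt_succ_self)
      have h2 : σ ⟨k, hk⟩ = τ ⟨k, hk⟩ := h _ k.lt_succ_self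
      simp only [stateAfter, hk, dif_pos, ih]
      unfold turn
      rw [h1, h2, weakOracle_congr h2]
    · simp only [stateAfter, hk, dif_neg, not_false_eq_true, ih]

theorem l2norm_stateAfter_succ_le (σ : Equiv.Perm (Fin n)) (k : ℕ) :
    l2norm (S.stateAfter σ (k + 1)) ≤ l2norm (S.stateAfter σ k) := by
  by_cases hk : k < n
  · simp only [stateAfter, hk, dif_pos]
    refine (l2norm_restrict_le _ _).trans_eq ?_
    exact l2norm_mulVec (runMatrix_mem_unitaryGroup _ _ _) _
  · simp [stateAfter, hk]

theorem l2norm_stateAfter_antitone (σ : Equiv.Perm (Fin n)) :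
    Antitone fun k => l2norm (S.stateAfter σ k) :=
  antitone_nat_of_succ_le (S.l2norm_stateAfter_succ_le σ)

theorem l2norm_init : l2norm S.init = 1 := by
  have := l2norm_sq S.init
  rw [S.init_norm] at this
  exact (pow_eq_one_iff_of_nonneg (l2norm_nonneg _) two_ne_zero).1 this

/-- Norms start at one and never increase; a sure win makes the last one equal to one, so none is
lost on the way. -/
theorem l2norm_stateAfter (hS : S.winProb = 1) (σ : Equiv.Perm (Fin n)) {k : ℕ} (hk : k ≤ n) :
    l2norm (S.stateAfter σ k) = 1 := by
  have hle : ∀ τ k, l2norm (S.stateAfter τ k) ≤ 1 := fun τ k =>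
    (S.l2norm_stateAfter_antitone τ k.zero_le).trans_eq S.l2norm_init
  have hn : S.winProbAt σ = 1 := by
    refine eq_one_of_average_eq_one (fun τ => ?_) hS σ
    rw [winProbAt, ← l2norm_sq]
    exact pow_le_one₀ (l2norm_nonneg _) (hle τ n)
  rw [winProbAt, ← l2norm_sq, pow_eq_one_iff_of_nonneg (l2norm_nonneg _) two_ne_zero] at hn
  exact le_antisymm (hle σ k) (hn ▸ S.l2norm_stateAfter_antitone σ hk)

theorem run_eq_zero_of_guess_ne (hS : S.winProb = 1) (σ : Equiv.Perm (Fin n)) (i : Fin n)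
    {a : QBasis n S.w} (ha : S.guess i (history σ i) a ≠ σ i) :
    (runMatrix (weakOracle σ i) (S.U i (history σ i)) (S.queries i (history σ i)) *ᵥ
      S.stateAfter σ i) a = 0 := by
  refine eq_zero_of_l2norm_le_restrict (p := fun a => S.guess i (history σ i) a = σ i) ?_ ha
  rw [l2norm_mulVec (runMatrix_mem_unitaryGroup _ _ _), S.l2norm_stateAfter hS σ i.isLt.le]
  have h := S.l2norm_stateAfter hS σ (k := i + 1) i.isLt
  simp only [stateAfter, i.isLt, dif_pos] at h
  exact h.ge

theorem le_queriesAt_sq (hS : S.winProb = 1) (σ : Equiv.Perm (Fin n)) (i : Fin n) :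
    (n : ℝ) - ((i : ℕ) + 1) ≤ 8 * (S.queriesAt σ i : ℝ) ^ 2 := by
  have hψ : S.stateAfter σ i ≠ 0 := by
    intro h
    have := S.l2norm_stateAfter hS σ i.isLt.le
    simp [h, l2norm] at this
  have h := card_le_of_exact_search (S.U i (history σ i)) hψ (S.queriesAt σ i)
    (S.guess i (history σ i)) ((Finset.Ici i).map σ.toEmbedding) ?_
  · rw [Finset.card_map, Fin.card_Ici, Nat.cast_sub i.isLt.le] at h
    linarith
  · intro x hx a ha
    obtain ⟨k, hk, rfl⟩ := Finset.mem_map.1 hx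
    have hk : i ≤ k := Finset.mem_Ici.1 hk
    -- `τ` agrees with `σ` before `i` and sends `i` to the target `σ k`.
    set τ : Equiv.Perm (Fin n) := σ * Equiv.swap i k
    have hτ : ∀ j < i, τ j = σ j := fun j hj => by
      simp [τ, Equiv.swap_apply_of_ne_of_ne hj.ne (hj.trans_le hk).ne]
    have hτi : τ i = σ k := by simp [τ]
    have hrun := S.run_eq_zero_of_guess_ne hS τ i (a := a)
    have hor : weakOracle τ i = fun y => decide (σ k = y) := by
      funext y
      simp [weakOracle, hτi]
    rw [history_congr hτ, S.stateAfter_congr i fun j hj => hτ j (Fin.lt_def.2 hj), hτi,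
      hor] at hrun
    exact hrun ha

end SeqStrategy

/-! ### Tensor products of unitaries -/

section Tensor

variable {ι : Type*} [Fintype ι] {κ : ι → Type*}

/-- The tensor product of a finite family of matrices. -/
def tensorMatrix (M : ∀ i, Matrix (κ i) (κ i) ℂ) : Matrix (∀ i, κ i) (∀ i, κ i) ℂ :=
  Matrix.of fun a b => ∏ i, M i (a i) (b i)

theorem tensorMatrix_mul [DecidableEq ι] [∀ i, Fintype (κ i)] (M N : ∀ i, Matrix (κ i) (κ i) ℂ) :
    tensorMatrix M * tensorMatrix N = tensorMatrix fun i => M i * N i := by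
  ext a c
  simp only [tensorMatrix, mul_apply, of_apply, ← Finset.prod_mul_distrib]
  rw [Finset.prod_univ_sum, Fintype.piFinset_univ]

theorem tensorMatrix_one [∀ i, DecidableEq (κ i)] : tensorMatrix (fun i => (1 : Matrix (κ i) (κ i) ℂ)) = 1 := by
  ext a b
  simp only [tensorMatrix, of_apply, one_apply, Finset.prod_ite_zero, funext_iff]
  simp

theorem star_tensorMatrix (M : ∀ i, Matrix (κ i) (κ i) ℂ) :
    star (tensorMatrix M) = tensorMatrix fun i => star (M i) := by
  ext a b
  simp [tensorMatrix, star_apply]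

theorem tensorMatrix_mem_unitaryGroup [DecidableEq ι] [∀ i, Fintype (κ i)]
    [∀ i, DecidableEq (κ i)] {M : ∀ i, Matrix (κ i) (κ i) ℂ}
    (hM : ∀ i, M i ∈ unitaryGroup (κ i) ℂ) :
    tensorMatrix M ∈ unitaryGroup (∀ i, κ i) ℂ := by
  rw [mem_unitaryGroup_iff, star_tensorMatrix, tensorMatrix_mul, ← tensorMatrix_one]
  congr 1
  funext i
  exact mem_unitaryGroup_iff.1 (hM i)

/-- A matrix acting on factor `i` of a tensor product. -/
def actOn [DecidableEq ι] [∀ i, DecidableEq (κ i)] (i : ι) (M : Matrix (κ i) (κ i) ℂ) :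
    ∀ j, Matrix (κ j) (κ j) ℂ :=
  Function.update (fun _ => 1) i M

theorem tensorMatrix_actOn_mulVec [DecidableEq ι] [∀ i, Fintype (κ i)]
    [∀ i, DecidableEq (κ i)] (i : ι) (M : Matrix (κ i) (κ i) ℂ)
    (v : (∀ j, κ j) → ℂ) (a : ∀ j, κ j) :
    (tensorMatrix (actOn i M) *ᵥ v) a = (M *ᵥ fun q => v (Function.update a i q)) (a i) := by
  simp only [mulVec, dotProduct]
  symm
  refine Finset.sum_of_injOn (Function.update a i) ?_ (by simp) ?_ ?_
  · exact (Function.update_injective a i).injOn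
  · intro b _ hb
    have : ∃ j, j ≠ i ∧ a j ≠ b j := by
      by_contra! h
      refine hb ⟨b i, by simp, ?_⟩
      funext j
      by_cases hj : j = i
      · subst hj; simp
      · simp [hj, h j hj]
    obtain ⟨j, hji, hj⟩ := this
    rw [tensorMatrix, of_apply, Finset.prod_eq_zero (mem_univ j), zero_mul]
    simp [actOn, hji, one_apply_ne hj]
  · intro q _
    congr 1
    rw [tensorMatrix, of_apply, Finset.prod_eq_single i]
    · simp [actOn]
    · intro j _ hj
      simp [actOn, hj]
    · simp

end Tensor

/-! ### The original game -/

namespace Strategy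

variable {n : ℕ} (S : Strategy n)

/-- The unitary that player `i` applies to his register when the permutation is `σ`. -/
noncomputable def playerMatrix (σ : Equiv.Perm (Fin n)) (i : Fin n) :
    Matrix (QBasis n (S.w i)) (QBasis n (S.w i)) ℂ :=
  runMatrix (weakOracle σ i) (S.U i) (S.queries i)

theorem playerMatrix_mem_unitaryGroup (σ : Equiv.Perm (Fin n)) (i : Fin n) :
    S.playerMatrix σ i ∈ unitaryGroup (QBasis n (S.w i)) ℂ :=
  runMatrix_mem_unitaryGroup _ _ _

theorem finalState_eq (σ : Equiv.Perm (Fin n)) :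
    S.finalState σ = tensorMatrix (S.playerMatrix σ) *ᵥ S.init := rfl

theorem l2norm_init : l2norm S.init = 1 := by
  have := l2norm_sq S.init
  rw [S.init_norm] at this
  exact (pow_eq_one_iff_of_nonneg (l2norm_nonneg _) two_ne_zero).1 this

theorem l2norm_finalState (σ : Equiv.Perm (Fin n)) : l2norm (S.finalState σ) = 1 := by
  rw [finalState_eq, l2norm_mulVec (tensorMatrix_mem_unitaryGroup
    (S.playerMatrix_mem_unitaryGroup σ)), l2norm_init]

theorem winProbAt_eq (σ : Equiv.Perm (Fin n)) :
    S.winProbAt σ =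
      l2norm (fun a => if ∀ i, S.guess i (a i) = σ i then S.finalState σ a else 0) ^ 2 := by
  rw [winProbAt, l2norm_sq, Finset.sum_filter]
  refine Finset.sum_congr rfl fun a _ => ?_
  split_ifs <;> simp

theorem finalState_eq_zero (hS : S.winProb = 1) (σ : Equiv.Perm (Fin n))
    {a : (i : Fin n) → QBasis n (S.w i)} (ha : ¬ ∀ i, S.guess i (a i) = σ i) :
    S.finalState σ a = 0 := by
  have h : S.winProbAt σ = 1 := by
    refine eq_one_of_average_eq_one (fun τ => ?_) hS σ
    rw [winProbAt_eq]
    exact pow_le_one₀ (l2norm_nonneg _)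
      ((l2norm_restrict_le _ _).trans_eq (S.l2norm_finalState τ))
  rw [winProbAt_eq, pow_eq_one_iff_of_nonneg (l2norm_nonneg _) two_ne_zero] at h
  refine eq_zero_of_l2norm_le_restrict
    (p := fun a : (i : Fin n) → QBasis n (S.w i) => ∀ i, S.guess i (a i) = σ i) ?_ ha
  rw [h, l2norm_finalState]

/-- Undoing the other players' unitaries, which does not change the register of player `i`, shows
that player `i` is right on each slice of the joint initial state along his register. -/
theorem run_eq_zero_of_guess_ne (hS : S.winProb = 1) (σ : Equiv.Perm (Fin n)) (i : Fin n)
    (e : (j : Fin n) → QBasis n (S.w j)) {q : QBasis n (S.w i)} (hq : S.guess i q ≠ σ i) :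
    (S.playerMatrix σ i *ᵥ fun r => S.init (Function.update e i r)) q = 0 := by
  set K : ∀ j, Matrix (QBasis n (S.w j)) (QBasis n (S.w j)) ℂ :=
    Function.update (fun j => star (S.playerMatrix σ j)) i 1 with hK
  have h1 : tensorMatrix K *ᵥ S.finalState σ =
      tensorMatrix (actOn i (S.playerMatrix σ i)) *ᵥ S.init := by
    rw [finalState_eq, mulVec_mulVec, tensorMatrix_mul]
    congr 2
    funext j
    by_cases hj : j = i
    · subst hj
      simp [hK, actOn]
    · simpa [hK, actOn, hj] using
        mem_unitaryGroup_iff'.1 (S.playerMatrix_mem_unitaryGroup σ j)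
  have h2 := congrFun h1 (Function.update e i q)
  rw [tensorMatrix_actOn_mulVec] at h2
  simp only [Function.update_idem, Function.update_self] at h2
  rw [← h2]
  refine Finset.sum_eq_zero fun b _ => ?_
  -- `K` is the identity on register `i`, so only `b` with `b i = q` contribute, and there the guess
  -- is wrong.
  by_cases hb : b i = q
  · rw [S.finalState_eq_zero hS σ (a := b) fun h => hq (hb ▸ h i), mul_zero]
  · have : tensorMatrix K (Function.update e i q) b = 0 := by
      rw [tensorMatrix, of_apply, Finset.prod_eq_zero (mem_univ i)]
      simp [hK, one_apply_ne (Ne.symm hb)]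
    exact mul_eq_zero_of_left this _

theorem le_queries_sq (hS : S.winProb = 1) (i : Fin n) :
    (n : ℝ) - 1 ≤ 8 * (S.queries i : ℝ) ^ 2 := by
  obtain ⟨e, he⟩ : ∃ e, S.init e ≠ 0 := by
    by_contra! h
    have := S.init_norm
    simp [h] at this
  have hψ : (fun r => S.init (Function.update e i r)) ≠ 0 := fun h =>
    he (by simpa using congrFun h (e i))
  have h := card_le_of_exact_search (S.U i) hψ (S.queries i) (S.guess i) univ ?_
  · rw [card_univ, Fintype.card_fin] at h
    linarith
  · intro x _ a ha
    have hσ : Equiv.swap i x i = x := Equiv.swap_apply_left i x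
    have hrun := S.run_eq_zero_of_guess_ne hS (Equiv.swap i x) i e (q := a) (by rwa [hσ])
    have hor : weakOracle (Equiv.swap i x) i = fun y => decide (x = y) := by
      funext y
      simp [weakOracle]
    rwa [playerMatrix, hor] at hrun

end Strategy

/-! ### Square-root sums and constants -/

theorem sqrt_le_three_mul {m t : ℝ} (ht : 0 ≤ t) (h : m ≤ 8 * t ^ 2) : √m ≤ 3 * t := by
  refine Real.sqrt_le_iff.2 ⟨by positivity, ?_⟩
  nlinarith

/-- Discrete form of `∫ √x`. It fails at `n = 1`, where the sum is zero. -/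
theorem mul_sqrt_le_sum_sqrt (n : ℕ) (hn : 2 ≤ n) :
    (n : ℝ) * √n ≤ 4 * ∑ j ∈ range n, √(j : ℝ) := by
  induction n, hn using Nat.le_induction with
  | base =>
    have : √(2 : ℝ) ≤ 2 := Real.sqrt_le_iff.2 (by norm_num)
    norm_num [Finset.sum_range_succ]
    linarith
  | succ n hn ih =>
    rw [Finset.sum_range_succ]
    have hn1 : (1 : ℝ) ≤ n := by exact_mod_cast (by omega : 1 ≤ n)
    have ha : √(n : ℝ) ^ 2 = n := Real.sq_sqrt (by positivity)
    have hb : √((n + 1 : ℕ) : ℝ) ^ 2 = n + 1 := by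
      rw [Real.sq_sqrt (by positivity)]
      push_cast
      ring
    have ha1 : 1 ≤ √(n : ℝ) := Real.one_le_sqrt.2 hn1
    have hb0 : 0 ≤ √((n + 1 : ℕ) : ℝ) := Real.sqrt_nonneg _
    push_cast at hb hb0 ⊢
    set a := √(n : ℝ)
    set b := √((n : ℝ) + 1)
    have hab : a ≤ b := by nlinarith
    have hb2 : b ≤ 2 * a := by nlinarith
    have hd : (b - a) * (2 * a) ≤ 1 := by nlinarith
    -- Since `b² - a² = 1`, the first factor is at most `1 / (2a)`, giving `7a / 2`.
    have hc : b ^ 3 - a ^ 3 ≤ 4 * a := by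
      have h1 : b ^ 3 - a ^ 3 = (b - a) * (b ^ 2 + a * b + a ^ 2) := by ring
      have h2 : b ^ 2 + a * b + a ^ 2 ≤ 7 * a ^ 2 := by nlinarith
      have h3 := mul_le_mul_of_nonneg_left h2 (sub_nonneg.2 hab)
      nlinarith
    rw [← hb]
    rw [← ha] at ih
    nlinarith

theorem sum_sqrt_rev (n : ℕ) :
    ∑ i : Fin n, √((n : ℝ) - ((i : ℕ) + 1 : ℝ)) = ∑ j ∈ range n, √(j : ℝ) := by
  rw [Fin.sum_univ_eq_sum_range (fun i => √((n : ℝ) - ((i : ℝ) + 1))) n,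
    ← Finset.sum_range_reflect]
  refine Finset.sum_congr rfl fun j hj => ?_
  have hj := Finset.mem_range.1 hj
  rw [Nat.sub_sub, Nat.cast_sub (by omega)]
  push_cast
  ring_nf

end LockerGame

theorem theorem2 :
    ∃ c : ℝ, 0 < c ∧ ∀ n : ℕ, 2 ≤ n →
      (∀ S : LockerGame.Strategy n, S.winProb = 1 →
        c * ((n : ℝ) * Real.sqrt (n : ℝ)) ≤ (S.totalQueries : ℝ)) ∧
      (∀ S : LockerGame.SeqStrategy n, S.winProb = 1 → ∀ σ : Equiv.Perm (Fin n),
        (∀ i : Fin n,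
          c * Real.sqrt ((n : ℝ) - ((i : ℕ) + 1 : ℝ)) ≤ (S.queriesAt σ i : ℝ)) ∧
        c * ((n : ℝ) * Real.sqrt (n : ℝ)) ≤ ((∑ i : Fin n, S.queriesAt σ i : ℕ) : ℝ)) := by
  -- `12 = 4 · 3`: the factor 4 from `mul_sqrt_le_sum_sqrt`, the 3 from rounding up `√8`.
  refine ⟨1 / 12, by norm_num, fun n hn => ⟨fun S hS => ?_, fun S hS σ => ?_⟩⟩
  · have hn2 : (2 : ℝ) ≤ n := by exact_mod_cast hn
    have hq : ∀ i, 1 / 12 * √(n : ℝ) ≤ (S.queries i : ℝ) := fun i => by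
      -- Uses `n / 4 ≤ n - 1`, true as `n ≥ 2`.
      have h1 : √((n : ℝ) / 4) ≤ 3 * (S.queries i : ℝ) :=
        LockerGame.sqrt_le_three_mul (by positivity) (by linarith [S.le_queries_sq hS i])
      have h2 : √(n : ℝ) / 2 = √((n : ℝ) / 4) := by
        rw [Real.sqrt_div (by positivity), show (4 : ℝ) = 2 ^ 2 by norm_num,
          Real.sqrt_sq (by norm_num)]
      linarith [Real.sqrt_nonneg (n : ℝ)]
    have hsum := Finset.sum_le_sum fun i (_ : i ∈ Finset.univ) => hq i
    rw [Finset.sum_const, Finset.card_univ, Fintype.card_fin, nsmul_eq_mul] at hsum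
    rw [LockerGame.Strategy.totalQueries]
    push_cast
    linarith
  · have hq : ∀ i : Fin n, √((n : ℝ) - ((i : ℕ) + 1 : ℝ)) ≤ 3 * (S.queriesAt σ i : ℝ) := fun i =>
      LockerGame.sqrt_le_three_mul (by positivity) (S.le_queriesAt_sq hS σ i)
    refine ⟨fun i => ?_, ?_⟩
    · linarith [hq i, Real.sqrt_nonneg ((n : ℝ) - ((i : ℕ) + 1 : ℝ))]
    · have hsum := Finset.sum_le_sum fun i (_ : i ∈ Finset.univ) => hq i
      rw [LockerGame.sum_sqrt_rev, ← Finset.mul_sum] at hsum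
      push_cast
      linarith [LockerGame.mul_sqrt_le_sum_sqrt n hn]
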